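/- Consider finite systems of quadratic Diophantine equations of the following two forms, given by integers $r,s\ge 0$ and integers $a^{(q)}_{ij}$ ($1\le i<j\le r$) and $b_q$, $q=1,\dots,s$. (Q-SYM) $\displaystyle\sum_{1\le i<j\le r} a^{(q)}_{ij}\,x_i x_j=b_q$ for $q=1,\dots,s$, with unknowns $x_1,\dots,x_r$ (quadratic forms with no square terms); (Q-SKEW) $\displaystyle\sum_{1\le i<j\le r} a^{(q)}_{ij}\,(x_i y_j-x_j y_i)=b_q$ for $q=1,\dots,s$, with unknowns $x_1,\dots,x_r,y_1,\dots,y_r$ (skew-symmetric bilinear forms). Then the solvability in integers of systems (Q-SYM) is algorithmically undecidable, and so is the solvability in integers of systems (Q-SKEW): for neither of the two forms is there an algorithm which, given $r$, $s$, all the $a^{(q)}_{ij}$ and all the $b_q$ as input, always halts and correctly decides whether the system has an integer solution. -/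

import Mathlib

/-- The integer data of a system of `s` quadratic equations in `r` (pairs of) unknowns:
coefficients `a q i j`, which are used only for `i < j`, and right-hand sides `b q`. -/
structure QuadSystem where
  r : ℕ
  s : ℕ
  a : Fin s → Fin r → Fin r → ℤ
  b : Fin s → ℤ

namespace QuadSystem

/-- Integer solvability of the system `∑_{i<j} a q i j * x i * x j = b q` for all `q`. -/
def SymSolvable (S : QuadSystem) : Prop :=
  ∃ x : Fin S.r → ℤ, ∀ q : Fin S.s,
    ∑ i, ∑ j ∈ Finset.Ioi i, S.a q i j * (x i * x j) = S.b q

/-- Integer solvability of the system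
`∑_{i<j} a q i j * (x i * y j - x j * y i) = b q` for all `q`. -/
def SkewSolvable (S : QuadSystem) : Prop :=
  ∃ x y : Fin S.r → ℤ, ∀ q : Fin S.s,
    ∑ i, ∑ j ∈ Finset.Ioi i, S.a q i j * (x i * y j - x j * y i) = S.b q

/-- Finite data in the form in which a system is given to an algorithm: the number `r`, and
for each equation the rows of its coefficient matrix and its right-hand side. -/
abbrev Code : Type := ℕ × List (List (List ℤ) × ℤ)

/-- The system written out as finite data. The coefficient matrix of each equation is written
with zeros on and below the diagonal, where the system has no coefficients. -/
def code (S : QuadSystem) : Code :=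
  (S.r, List.ofFn fun q =>
    (List.ofFn fun i => List.ofFn fun j => if i < j then S.a q i j else 0, S.b q))

/-- A property of systems is algorithmically decidable if some partial recursive function, run on
the code of any system, halts and tells correctly whether the system has the property (its
behaviour on data that are not the code of a system does not matter). -/
def AlgDecidable (P : QuadSystem → Prop) : Prop :=
  ∃ d : Code →. Bool, Partrec d ∧
    ∀ S : QuadSystem, (P S → true ∈ d S.code) ∧ (¬ P S → false ∈ d S.code)

end QuadSystem

/-! Both problems encode a noncomputable Diophantine set. Starting from the Diophantine character of
exponentiation (`Dioph.pow_dioph`), binomials, factorials and products of arithmetic progressions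
are Diophantine. Davis's argument then eliminates bounded universal quantifiers
(`Dioph.forall_lt_dioph`), and Gödel's beta function makes primitive recursive functions
Diophantine, so the halting set is Diophantine. Lagrange's four squares and names for intermediate
values reduce membership of `n` to integer equations `x = c`, `x = y - z`, `x = y * z` together with
`x₀ = n`.

It remains to simulate these by the two kinds of forms (`not_algDecidable_of_gadget`). Take
auxiliary unknowns `e`, `w` with `⟨e, w⟩ = 1` and two copies `p`, `p'` of each unknown, its value
being `⟨p, w⟩ = ⟨e, p'⟩`. Constants and differences are linear in the values, and the product of the
values of `p` and `q` is `⟨p, q'⟩`. For the symmetric form this is rearrangement of factors; for the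
skew form, a determinant in the plane, it is the Plücker relation once `⟨e, p⟩ = 0` is imposed. -/

/-! ### Binomials, factorials and products are Diophantine -/

open Finset in
theorem Nat.sum_mul_pow_lt {u : ℕ} {d : ℕ → ℕ} (hd : ∀ i, d i < u) (k : ℕ) :
    ∑ i ∈ range k, d i * u ^ i < u ^ k := by
  induction k with
  | zero => simp
  | succ k ih =>
    rw [sum_range_succ, pow_succ]
    have h : (d k + 1) * u ^ k ≤ u * u ^ k := Nat.mul_le_mul_right _ (hd k)
    linarith

-- With `u = 2 ^ n + 1`, the binomial expansion of `(u + 1) ^ n` is its base-`u` expansion, since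
-- every coefficient is below `u`.
open Finset in
theorem Nat.choose_eq_digit (n k : ℕ) :
    n.choose k = (2 ^ n + 2) ^ n / (2 ^ n + 1) ^ k % (2 ^ n + 1) := by
  set u := 2 ^ n + 1 with hu
  have hd : ∀ i, n.choose i < u := fun i => Nat.lt_succ_of_le (Nat.choose_le_two_pow n i)
  -- The range goes beyond `n` so that splitting at digit `k` also covers `k > n`.
  have hexp : (2 ^ n + 2) ^ n = ∑ i ∈ range (k + (n + 1)), n.choose i * u ^ i := by
    rw [show 2 ^ n + 2 = u + 1 from rfl, add_pow, add_comm k,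
      sum_range_add (fun i => n.choose i * u ^ i)]
    simp only [one_pow, mul_one]
    rw [sum_eq_zero (s := range k) (f := fun i => n.choose (n + 1 + i) * u ^ (n + 1 + i)), add_zero]
    · exact sum_congr rfl fun i _ => by simp [mul_comm]
    · intro i _
      rw [Nat.choose_eq_zero_of_lt (by omega), zero_mul]
  have hsplit : (2 ^ n + 2) ^ n = ∑ i ∈ range k, n.choose i * u ^ i +
      u ^ k * (n.choose k + u * ∑ i ∈ range n, n.choose (k + (i + 1)) * u ^ i) := by
    rw [hexp, sum_range_add, sum_range_succ', mul_add, mul_sum, mul_sum]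
    congr 1
    rw [add_comm]
    congr 1
    · simp [mul_comm]
    · exact sum_congr rfl fun i _ => by ring
  rw [hsplit, Nat.add_mul_div_left _ _ (by positivity),
    Nat.div_eq_of_lt (Nat.sum_mul_pow_lt hd k), zero_add, Nat.add_mul_mod_self_left,
    Nat.mod_eq_of_lt (hd k)]

/-- For large `r` the falling factorial is so close to `r ^ n` (Bernoulli) that the quotient lies
between `n!` and `n! + 1`. -/
theorem Nat.factorial_eq_pow_div_choose {n r : ℕ} (hr : n * n * (Nat.factorial n + 1) < r) :
    Nat.factorial n = r ^ n / r.choose n := by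
  have hnr : n ≤ r := by nlinarith
  have hdesc := Nat.descFactorial_eq_factorial_mul_choose r n
  have hc : 0 < r.choose n := Nat.choose_pos hnr
  symm
  rw [Nat.div_eq_iff hc]
  have hle : r.descFactorial n ≤ r ^ n := Nat.descFactorial_le_pow r n
  have hpow : (r - n) ^ n ≤ r.descFactorial n :=
    (Nat.pow_le_pow_left (by omega) n).trans (Nat.pow_sub_le_descFactorial r n)
  have hr0 : (0 : ℚ) < r := by exact_mod_cast (Nat.zero_le _).trans_lt hr
  have hnr' : (n : ℚ) / r ≤ 1 := (div_le_one hr0).2 (by exact_mod_cast hnr)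
  have hb : 1 + (n : ℚ) * (-(n / r)) ≤ (1 + -(n / r)) ^ n :=
    one_add_mul_le_pow (by linarith) n
  have hq : (1 + -((n : ℚ) / r)) ^ n = ((r - n : ℕ) : ℚ) ^ n / (r : ℚ) ^ n := by
    rw [← div_pow, Nat.cast_sub hnr, sub_div, div_self hr0.ne', sub_eq_add_neg]
  rw [hq, le_div_iff₀ (by positivity)] at hb
  have hpow' : ((r - n : ℕ) : ℚ) ^ n ≤ Nat.factorial n * r.choose n := by
    exact_mod_cast hdesc ▸ hpow
  have hF : (0 : ℚ) < Nat.factorial n := by exact_mod_cast n.factorial_pos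
  have hs : (n : ℚ) * (n / r) * (Nat.factorial n + 1) < 1 := by
    rw [mul_div_assoc', div_mul_eq_mul_div, div_lt_one hr0]
    exact_mod_cast hr
  have hlt : (r : ℚ) ^ n < (Nat.factorial n + 1) * r.choose n := by
    have hR : (0 : ℚ) < (r : ℚ) ^ n := by positivity
    have h1 : (1 + (n : ℚ) * (-(n / r))) * r ^ n * (Nat.factorial n + 1) ≤
        Nat.factorial n * r.choose n * (Nat.factorial n + 1) :=
      mul_le_mul_of_nonneg_right (hb.trans hpow') (by positivity)
    have h2 : (r : ℚ) ^ n * (n * (n / r) * (Nat.factorial n + 1)) < r ^ n * 1 :=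
      mul_lt_mul_of_pos_left hs hR
    refine lt_of_mul_lt_mul_left (a := (Nat.factorial n : ℚ)) ?_ hF.le
    nlinarith
  have hlt' : r ^ n < (Nat.factorial n + 1) * r.choose n := by exact_mod_cast hlt
  rw [hdesc] at hle
  constructor
  · exact hle
  · rw [add_mul, one_mul] at hlt'
    omega

-- Modulo `t * A + 1`, where `A = (1 + y * t) ^ y`, one has `(t * A) ^ 2 ≡ 1`, so each factor `1 +
-- (k + 1) * t` becomes `t` times a term of an ascending factorial. The modulus exceeds the product,
-- so the remainder is the product itself.
open Finset in
theorem Nat.prod_one_add_mul_eq_mod {t : ℕ} (ht : 0 < t) (y : ℕ) :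
    ∏ k ∈ range y, (1 + (k + 1) * t) =
      t ^ y * (Nat.factorial y * ((1 + y * t) ^ y * (t * (1 + y * t) ^ y) + y).choose y) %
        (t * (1 + y * t) ^ y + 1) := by
  set A := (1 + y * t) ^ y
  have hlt : ∏ k ∈ range y, (1 + (k + 1) * t) < t * A + 1 := by
    have : ∏ k ∈ range y, (1 + (k + 1) * t) ≤ ∏ k ∈ range y, (1 + y * t) := by
      refine prod_le_prod' fun k hk => ?_
      have : k + 1 ≤ y := by simpa using hk
      gcongr
    rw [prod_const, card_range] at this
    have h2 : 1 * A ≤ t * A := Nat.mul_le_mul_right _ ht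
    omega
  rw [← Nat.mod_eq_of_lt hlt]
  change _ ≡ _ [MOD _]
  rw [← Nat.ascFactorial_eq_factorial_mul_choose, Nat.ascFactorial_eq_prod_range]
  have : t ^ y = ∏ k ∈ range y, t := by simp
  rw [this, ← prod_mul_distrib]
  refine Nat.ModEq.prod fun k _ => ?_
  have h0 : t * (A * (t * A) + 1 + k) = (1 + (k + 1) * t) + (t * A + 1) * (t * A - 1) := by
    have : 1 ≤ t * A := Nat.succ_le_of_lt (by positivity)
    obtain ⟨b, hb⟩ := Nat.exists_eq_add_of_le this
    have : t * (A * (t * A) + 1 + k) = (t * A) * (t * A) + t + t * k := by ring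
    rw [this, hb, Nat.add_sub_cancel_left]; ring
  rw [h0]
  simp [Nat.ModEq]

namespace Dioph

variable {α : Type} {f g h : (α → ℕ) → ℕ}

theorem choose_dioph (df : DiophFn f) (dg : DiophFn g) :
    DiophFn fun v => (f v).choose (g v) := by
  have d2 := pow_dioph (const_dioph 2) df
  simp only [Nat.choose_eq_digit]
  exact mod_dioph (div_dioph (pow_dioph (add_dioph d2 (const_dioph 2)) df)
    (pow_dioph (add_dioph d2 (const_dioph 1)) dg)) (add_dioph d2 (const_dioph 1))

theorem factorial_dioph (df : DiophFn f) : DiophFn fun v => Nat.factorial (f v) := by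
  -- Replacing `n!` by `n ^ n` gives a sufficiently large `r` that is already known to be
  -- Diophantine.
  have h : ∀ n : ℕ, n * n * (Nat.factorial n + 1) < n * n * (n ^ n + 1) + 1 := fun n => by
    have := Nat.factorial_le_pow n
    exact Nat.lt_succ_of_le (by gcongr)
  simp only [fun n => Nat.factorial_eq_pow_div_choose (h n)]
  have dr := add_dioph (mul_dioph (mul_dioph df df)
    (add_dioph (pow_dioph df df) (const_dioph 1))) (const_dioph 1)
  exact div_dioph (pow_dioph dr df) (choose_dioph dr df)

theorem descFactorial_dioph (df : DiophFn f) (dg : DiophFn g) :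
    DiophFn fun v => (f v).descFactorial (g v) := by
  simp only [Nat.descFactorial_eq_factorial_mul_choose]
  exact mul_dioph (factorial_dioph dg) (choose_dioph df dg)

theorem prod_one_add_mul_dioph (df : DiophFn f) (dg : DiophFn g) (hg : ∀ v, 0 < g v) :
    DiophFn fun v => ∏ k ∈ Finset.range (f v), (1 + (k + 1) * g v) := by
  simp only [Nat.prod_one_add_mul_eq_mod (hg _)]
  have dA := pow_dioph (add_dioph (const_dioph 1) (mul_dioph df dg)) df
  have dB := mul_dioph dg dA
  exact mod_dioph (mul_dioph (pow_dioph dg df) (mul_dioph (factorial_dioph df)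
    (choose_dioph (add_dioph (mul_dioph dA dB) df) df))) (add_dioph dB (const_dioph 1))

end Dioph

/-! ### Elimination of bounded universal quantifiers -/

/-- Makes Davis's argument finite: only variables in `s` matter for congruences, and `Q`, obtained
by taking absolute values of constants and turning differences into sums, bounds `p` monotonically.
-/
theorem Poly.exists_support_majorant {γ : Type*} (p : Poly γ) :
    ∃ (s : Finset γ) (Q : Poly γ),
      (∀ (n : ℕ) (v w : γ → ℕ), (∀ i ∈ s, v i ≡ w i [MOD n]) → p v ≡ p w [ZMOD n]) ∧
      ∀ v w : γ → ℕ, (∀ i ∈ s, v i ≤ w i) → |p v| ≤ Q w := by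
  classical
  induction p using Poly.induction with
  | H1 i =>
    refine ⟨{i}, Poly.proj i, fun n v w h => ?_, fun v w h => ?_⟩
    · exact Int.natCast_modEq_iff.2 (h i (by simp))
    · simpa using h i (by simp)
  | H2 n => exact ⟨∅, Poly.const |n|, fun _ _ _ _ => Int.ModEq.refl _, fun _ _ _ => by simp⟩
  | H3 f g hf hg =>
    obtain ⟨s, P, hs, hP⟩ := hf
    obtain ⟨t, Q, ht, hQ⟩ := hg
    refine ⟨s ∪ t, P + Q, fun n v w h => ?_, fun v w h => ?_⟩
    · exact (hs n v w fun i hi => h i (by simp [hi])).sub (ht n v w fun i hi => h i (by simp [hi]))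
    · exact (abs_sub _ _).trans
        (add_le_add (hP v w fun i hi => h i (by simp [hi])) (hQ v w fun i hi => h i (by simp [hi])))
  | H4 f g hf hg =>
    obtain ⟨s, P, hs, hP⟩ := hf
    obtain ⟨t, Q, ht, hQ⟩ := hg
    refine ⟨s ∪ t, P * Q, fun n v w h => ?_, fun v w h => ?_⟩
    · exact (hs n v w fun i hi => h i (by simp [hi])).mul (ht n v w fun i hi => h i (by simp [hi]))
    · have h1 := hP v w fun i hi => h i (by simp [hi])
      have h2 := hQ v w fun i hi => h i (by simp [hi])
      rw [Poly.mul_apply, Poly.mul_apply, abs_mul]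
      exact mul_le_mul h1 h2 (abs_nonneg _) ((abs_nonneg _).trans h1)

/-- With its converse for primes below, this turns "`a` has a residue representative at most `u`"
into a divisibility by `a (a - 1) ⋯ (a - u)`. -/
theorem Nat.dvd_descFactorial_of_modEq {m a t u : ℕ} (ht : t ≤ u) (h : a ≡ t [MOD m]) :
    m ∣ a.descFactorial (u + 1) := by
  rw [Nat.descFactorial_eq_prod_range]
  rcases le_total t a with hta | hat
  · exact ((Nat.modEq_iff_dvd' hta).1 h.symm).trans
      (Finset.dvd_prod_of_mem _ (by simpa using Nat.lt_succ_of_le ht))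
  · rw [Finset.prod_eq_zero (i := a) (by simpa using by omega) (Nat.sub_self a)]
    exact dvd_zero m

theorem Nat.Prime.exists_modEq_of_dvd_descFactorial {q a u : ℕ} (hq : q.Prime)
    (h : q ∣ a.descFactorial (u + 1)) : ∃ t ≤ u, t ≡ a [MOD q] := by
  rw [Nat.descFactorial_eq_prod_range, hq.prime.dvd_finsetProd_iff] at h
  obtain ⟨j, hj, hd⟩ := h
  have hj : j ≤ u := by simpa [Nat.lt_succ_iff] using hj
  rcases le_total j a with hja | haj
  · exact ⟨j, hj, (Nat.modEq_iff_dvd' hja).2 hd⟩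
  · exact ⟨a, haj.trans hj, rfl⟩

theorem Nat.coprime_one_add_mul {i j y t : ℕ} (hi : i < y) (hj : j < y) (hij : i ≠ j)
    (ht : ∀ d, 0 < d → d ≤ y → d ∣ t) : Nat.Coprime (1 + (i + 1) * t) (1 + (j + 1) * t) := by
  wlog hlt : i < j generalizing i j
  · exact (this hj hi hij.symm (by omega)).symm
  rw [add_comm 1, add_comm 1]
  exact Nat.coprime_mul_succ (ht _ (by omega) (by omega))

theorem Nat.exists_modEq_one_add_mul {y t : ℕ} (ht : ∀ d, 0 < d → d ≤ y → d ∣ t)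
    (a : ℕ → ℕ) : ∃ c, ∀ k < y, c ≡ a k [MOD 1 + (k + 1) * t] := by
  obtain ⟨c, hc⟩ := Nat.chineseRemainderOfFinset a (fun k => 1 + (k + 1) * t) (Finset.range y)
    (fun _ _ => by positivity) (fun i hi j hj hij => Nat.coprime_one_add_mul
      (by simpa using hi) (by simpa using hj) hij ht)
  exact ⟨c, fun k hk => hc k (by simpa using hk)⟩

local infixr:67 " ::ₒ " => Option.elim'
local infixr:65 " ⊗ " => Sum.elim

/-- The arithmetical core of Davis's elimination of bounded universal quantifiers: witnesses for
all `k < v none` are coded by a single tuple `a` modulo the numbers `1 + (k + 1) * T`. -/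
theorem Poly.forall_lt_exists_eq_zero_iff {α β : Type*} {p Q : Poly (Option α ⊕ β)}
    {s : Finset (Option α ⊕ β)}
    (hs : ∀ (n : ℕ) v w, (∀ i ∈ s, v i ≡ w i [MOD n]) → p v ≡ p w [ZMOD n])
    (hQ : ∀ v w, (∀ i ∈ s, v i ≤ w i) → |p v| ≤ Q w) (y : ℕ) (v : α → ℕ) :
    (∀ k < y, ∃ t, p ((k ::ₒ v) ⊗ t) = 0) ↔
      ∃ (a : β → ℕ) (u c T : ℕ),
        T = Nat.factorial ((Q ((y ::ₒ v) ⊗ fun _ => u)).natAbs + u + y) ∧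
        (∏ k ∈ Finset.range y, (1 + (k + 1) * T)) ∣ 1 + (c + 1) * T ∧
        (∏ k ∈ Finset.range y, (1 + (k + 1) * T)) ∣ (p ((c ::ₒ v) ⊗ a)).natAbs ∧
        ∀ b, Sum.inr b ∈ s →
          (∏ k ∈ Finset.range y, (1 + (k + 1) * T)) ∣ (a b).descFactorial (u + 1) := by
  classical
  constructor
  · intro h
    choose! t ht using h
    obtain ⟨u, hu⟩ : ∃ u, ∀ k < y, ∀ b, Sum.inr b ∈ s → t k b ≤ u := by
      refine ⟨∑ k ∈ Finset.range y, ∑ i ∈ s, Sum.elim (fun _ => 0) (t k) i, fun k hk b hb => ?_⟩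
      calc t k b ≤ ∑ i ∈ s, Sum.elim (fun _ => 0) (t k) i :=
            Finset.single_le_sum (f := Sum.elim (fun _ => 0) (t k)) (fun _ _ => Nat.zero_le _) hb
        _ ≤ _ := Finset.single_le_sum
            (f := fun k => ∑ i ∈ s, Sum.elim (fun _ => 0) (t k) i) (fun _ _ => Nat.zero_le _)
            (by simpa using hk)
    set T := Nat.factorial ((Q ((y ::ₒ v) ⊗ fun _ => u)).natAbs + u + y) with hT
    have hdvd : ∀ d, 0 < d → d ≤ y → d ∣ T := fun d h0 hd => Nat.dvd_factorial h0 (by omega)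
    have hprod : ∀ n : ℕ, (∀ k < y, 1 + (k + 1) * T ∣ n) →
        (∏ k ∈ Finset.range y, (1 + (k + 1) * T)) ∣ n := fun n hn => by
      refine Finset.prod_dvd_of_isRelPrime (fun i hi j hj hij => ?_)
        (fun k hk => hn k (by simpa using hk))
      exact Nat.coprime_iff_isRelPrime.1
        (Nat.coprime_one_add_mul (by simpa using hi) (by simpa using hj) hij hdvd)
    obtain ⟨c, hc⟩ := Nat.exists_modEq_one_add_mul hdvd id
    choose a ha using fun b => Nat.exists_modEq_one_add_mul hdvd fun k => t k b
    refine ⟨a, u, c, T, rfl, hprod _ fun k hk => ?_, hprod _ fun k hk => ?_,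
      fun b hb => hprod _ fun k hk => Nat.dvd_descFactorial_of_modEq (hu k hk b hb) (ha b k hk)⟩
    · have := ((hc k hk).add_right 1).mul_right T |>.add_left 1
      exact (this.dvd_iff dvd_rfl).2 dvd_rfl
    · rw [← Int.natCast_dvd]
      have := hs (1 + (k + 1) * T) ((c ::ₒ v) ⊗ a) ((k ::ₒ v) ⊗ t k) (by
        rintro ((_ | i) | b) -
        · exact hc k hk
        · rfl
        · exact ha b k hk)
      rw [ht k hk] at this
      exact Int.modEq_zero_iff_dvd.1 this
  · rintro ⟨a, u, c, T, hT, hc, hp, ha⟩ k hk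
    -- A prime factor of `1 + (k + 1) * T` cannot divide the factorial `T`, so it exceeds the bound
    -- on `|p|`; hence `p ≡ 0` modulo `q` forces `p = 0`.
    set q := (1 + (k + 1) * T).minFac with hq
    have hTpos : 0 < T := hT ▸ Nat.factorial_pos _
    have hqp : q.Prime := Nat.minFac_prime (by simp [hTpos.ne'])
    have hqk : q ∣ 1 + (k + 1) * T := Nat.minFac_dvd _
    have hqM : q ∣ ∏ k ∈ Finset.range y, (1 + (k + 1) * T) :=
      hqk.trans (Finset.dvd_prod_of_mem (fun k => 1 + (k + 1) * T) (by simpa using hk))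
    have hqT : ¬ q ∣ T := fun h =>
      hqp.one_lt.ne' (Nat.dvd_one.1 ((Nat.dvd_add_left (h.mul_left _)).1 hqk))
    have hqB : (Q ((y ::ₒ v) ⊗ fun _ => u)).natAbs + u + y < q := by
      rw [hT, hqp.dvd_factorial] at hqT
      omega
    have hkc : k ≡ c [MOD q] := by
      have h1 : 1 + (k + 1) * T ≡ 1 + (c + 1) * T [MOD q] :=
        ((Nat.modEq_zero_iff_dvd.2 hqk).trans (Nat.modEq_zero_iff_dvd.2 (hqM.trans hc)).symm)
      have h2 := Nat.ModEq.add_left_cancel' 1 h1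
      exact Nat.ModEq.add_right_cancel' 1 (h2.cancel_right_of_coprime
        ((Nat.Prime.coprime_iff_not_dvd hqp).2 hqT))
    have : ∀ b, ∃ t, Sum.inr b ∈ s → t ≤ u ∧ t ≡ a b [MOD q] := fun b => by
      by_cases hb : Sum.inr b ∈ s
      · obtain ⟨t, h1, h2⟩ := hqp.exists_modEq_of_dvd_descFactorial (hqM.trans (ha b hb))
        exact ⟨t, fun _ => ⟨h1, h2⟩⟩
      · exact ⟨0, fun h => absurd h hb⟩
    choose t ht using this
    refine ⟨t, ?_⟩
    have hmod := hs q ((k ::ₒ v) ⊗ t) ((c ::ₒ v) ⊗ a) (by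
      rintro ((_ | i) | b) hi
      · exact hkc
      · rfl
      · exact (ht b hi).2)
    have hle := hQ ((k ::ₒ v) ⊗ t) ((y ::ₒ v) ⊗ fun _ => u) (by
      rintro ((_ | i) | b) hi
      · exact hk.le
      · exact le_rfl
      · exact (ht b hi).1)
    have hd : (q : ℤ) ∣ p ((k ::ₒ v) ⊗ t) := by
      refine Int.modEq_zero_iff_dvd.1 (hmod.trans (Int.modEq_zero_iff_dvd.2 ?_))
      exact Int.natCast_dvd.2 (hqM.trans hp)
    exact Int.eq_zero_of_abs_lt_dvd hd (by omega)

namespace Dioph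

variable {α : Type}

theorem forall_mem_finset_dioph {ι : Type*} (s : Finset ι) {S : ι → Set (α → ℕ)}
    (h : ∀ i ∈ s, Dioph (S i)) : Dioph {v | ∀ i ∈ s, v ∈ S i} := by
  classical
  induction s using Finset.induction with
  | empty => exact ext (eq_dioph (const_dioph 0) (const_dioph 0)) fun v => by simp
  | insert i s _ ih =>
    exact ext (inter (h i (by simp)) (ih fun j hj => h j (by simp [hj]))) fun v => by simp

theorem forall_lt_dioph {S : Set (Option α → ℕ)} (hS : Dioph S) {f : (α → ℕ) → ℕ}
    (df : DiophFn f) : Dioph {v | ∀ k < f v, (k ::ₒ v) ∈ S} := by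
  suffices h : Dioph {w : Option α → ℕ | ∀ k < w none, (k ::ₒ w ∘ some) ∈ S} from
    ext (diophFn_comp1 h df) fun v => Iff.rfl
  obtain ⟨β, p, hp⟩ := hS
  obtain ⟨s, Q, hs, hQ⟩ := p.exists_support_majorant
  let s' : Finset β := s.preimage Sum.inr Sum.inr_injective.injOn
  -- variables: `T`, `c`, `u`, then `Sum.inl none = y`, `Sum.inl (some i)`, and `Sum.inr b = a b`
  let V := Option (Option (Option (Option α ⊕ β)))
  have dT : DiophFn fun w : V → ℕ => w none := proj_dioph _
  have dc : DiophFn fun w : V → ℕ => w (some none) := proj_dioph _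
  have du : DiophFn fun w : V → ℕ => w (some (some none)) := proj_dioph _
  have dy : DiophFn fun w : V → ℕ => w (some (some (some (Sum.inl none)))) := proj_dioph _
  let emb : Option α ⊕ β → V := fun i => some (some (some i))
  have dQ := abs_poly_dioph (Q.map (β := V)
    ((fun i => emb (Sum.inl i)) ⊗ fun _ => some (some none)))
  have dP := abs_poly_dioph (p.map (β := V)
    ((some none ::ₒ fun i => emb (Sum.inl (some i))) ⊗ fun b => emb (Sum.inr b)))
  -- `T - 1 + 1` is positive at every assignment, as `prod_one_add_mul_dioph` demands, and equals
  -- `T` once `T` is a factorial.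
  have dM : DiophFn fun w : V → ℕ => ∏ k ∈ Finset.range (w (emb (Sum.inl none))),
      (1 + (k + 1) * (w none - 1 + 1)) :=
    prod_one_add_mul_dioph dy (add_dioph (sub_dioph dT (const_dioph 1)) (const_dioph 1))
      fun _ => Nat.succ_pos _
  have key := inter (eq_dioph dT (factorial_dioph (add_dioph (add_dioph dQ du) dy)))
    (inter (dvd_dioph dM
      (add_dioph (const_dioph 1) (mul_dioph (add_dioph dc (const_dioph 1)) dT)))
    (inter (dvd_dioph dM dP) (forall_mem_finset_dioph s' fun b _ =>
      dvd_dioph dM (descFactorial_dioph (proj_dioph (emb (Sum.inr b)))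
        (add_dioph du (const_dioph 1))))))
  refine ext (ex_dioph (ex1_dioph (ex1_dioph (ex1_dioph key)))) fun w => ?_
  simp only [Set.mem_ofPred_eq, hp]
  rw [Poly.forall_lt_exists_eq_zero_iff hs hQ]
  refine exists_congr fun a => exists_congr fun u => exists_congr fun c => exists_congr fun T => ?_
  set x : V → ℕ := T ::ₒ c ::ₒ u ::ₒ (w ⊗ a)
  have e1 : x ∘ ((fun i => emb (Sum.inl i)) ⊗ fun _ : β => some (some none)) =
      (w none ::ₒ w ∘ some) ⊗ fun _ : β => u := by
    ext ((_ | i) | b) <;> rfl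
  have e2 : x ∘ ((some none ::ₒ fun i => emb (Sum.inl (some i))) ⊗ fun b => emb (Sum.inr b)) =
      (c ::ₒ w ∘ some) ⊗ a := by
    ext ((_ | i) | b) <;> rfl
  rw [← e1, ← e2]
  change (T = Nat.factorial ((Q (x ∘ _)).natAbs + u + w none) ∧
    ∏ k ∈ Finset.range (w none), (1 + (k + 1) * (T - 1 + 1)) ∣ 1 + (c + 1) * T ∧
    ∏ k ∈ Finset.range (w none), (1 + (k + 1) * (T - 1 + 1)) ∣ (p (x ∘ _)).natAbs ∧
    ∀ b ∈ s', ∏ k ∈ Finset.range (w none), (1 + (k + 1) * (T - 1 + 1)) ∣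
      (a b).descFactorial (u + 1)) ↔ _
  refine and_congr_right fun hT => ?_
  have hT1 : T - 1 + 1 = T := Nat.sub_add_cancel (hT ▸ Nat.factorial_pos _)
  rw [hT1]
  simp only [s', Finset.mem_preimage]

end Dioph

/-! ### Primitive recursion and the halting set -/

theorem Nat.exists_beta_eq (s : ℕ → ℕ) (n : ℕ) : ∃ c, ∀ i ≤ n, Nat.beta c i = s i := by
  refine ⟨Nat.unbeta ((List.range (n + 1)).map s), fun i hi => ?_⟩
  have := Nat.beta_unbeta_coe ((List.range (n + 1)).map s) ⟨i, by simpa using by omega⟩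
  simpa using this

/-- Coding all intermediate values in one number `c` leaves a single bounded universal quantifier.
-/
theorem Nat.rec_eq_iff_exists_beta {z : ℕ} {g : ℕ → ℕ → ℕ} {n x : ℕ} :
    (Nat.rec z g n : ℕ) = x ↔ ∃ c, Nat.beta c 0 = z ∧
      (∀ k < n, Nat.beta c (k + 1) = g k (Nat.beta c k)) ∧ Nat.beta c n = x := by
  constructor
  · rintro rfl
    obtain ⟨c, hc⟩ := Nat.exists_beta_eq (Nat.rec z g) n
    exact ⟨c, hc 0 (Nat.zero_le _), fun k hk => by rw [hc _ hk, hc _ hk.le], hc n le_rfl⟩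
  · rintro ⟨c, h0, hs, rfl⟩
    have : ∀ k ≤ n, Nat.beta c k = Nat.rec z g k := fun k => by
      induction k with
      | zero => exact fun _ => h0
      | succ k ih => exact fun hk => by rw [hs k hk, ih (Nat.le_of_succ_le hk)]
    exact (this n le_rfl).symm

namespace Dioph

variable {α : Type} {f g : (α → ℕ) → ℕ}

theorem pair_dioph (df : DiophFn f) (dg : DiophFn g) : DiophFn fun v => Nat.pair (f v) (g v) := by
  have df' := reindex_diophFn (β := Option α) some df
  have dg' := reindex_diophFn (β := Option α) some dg
  have dx : DiophFn fun v : Option α → ℕ => v none := proj_dioph _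
  refine ext (union
    (inter (lt_dioph df' dg') (eq_dioph (add_dioph (mul_dioph dg' dg') df') dx))
    (inter (le_dioph dg' df') (eq_dioph (add_dioph (add_dioph (mul_dioph df' df') df') dg') dx)))
    fun v => ?_
  change (f (v ∘ some) < g (v ∘ some) ∧ g (v ∘ some) * g (v ∘ some) + f (v ∘ some) = v none ∨
    g (v ∘ some) ≤ f (v ∘ some) ∧
      f (v ∘ some) * f (v ∘ some) + f (v ∘ some) + g (v ∘ some) = v none) ↔
    Nat.pair (f (v ∘ some)) (g (v ∘ some)) = v none
  unfold Nat.pair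
  split_ifs with h
  · simp [h, not_le.2 h]
  · simp [h, not_lt.1 h]

theorem unpair_fst_dioph (df : DiophFn f) : DiophFn fun v => (Nat.unpair (f v)).1 := by
  refine ext (ex1_dioph (eq_dioph (pair_dioph (proj_dioph (some none)) (proj_dioph none))
    (reindex_diophFn (β := Option (Option α)) (some ∘ some) df))) fun v => ?_
  change (∃ b, Nat.pair (v none) b = f (v ∘ some)) ↔ (Nat.unpair (f (v ∘ some))).1 = v none
  constructor
  · rintro ⟨b, hb⟩
    rw [← hb, Nat.unpair_pair]
  · intro h
    exact ⟨(Nat.unpair (f (v ∘ some))).2, by rw [← h, Nat.pair_unpair]⟩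

theorem unpair_snd_dioph (df : DiophFn f) : DiophFn fun v => (Nat.unpair (f v)).2 := by
  refine ext (ex1_dioph (eq_dioph (pair_dioph (proj_dioph none) (proj_dioph (some none)))
    (reindex_diophFn (β := Option (Option α)) (some ∘ some) df))) fun v => ?_
  change (∃ b, Nat.pair b (v none) = f (v ∘ some)) ↔ (Nat.unpair (f (v ∘ some))).2 = v none
  constructor
  · rintro ⟨b, hb⟩
    rw [← hb, Nat.unpair_pair]
  · intro h
    exact ⟨(Nat.unpair (f (v ∘ some))).1, by rw [← h, Nat.pair_unpair]⟩

theorem beta_dioph (df : DiophFn f) (dg : DiophFn g) : DiophFn fun v => Nat.beta (f v) (g v) :=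
  mod_dioph (unpair_fst_dioph df) (add_dioph (mul_dioph (add_dioph dg (const_dioph 1))
    (unpair_snd_dioph df)) (const_dioph 1))

theorem natPrimrec_dioph {F : ℕ → ℕ} (hF : Nat.Primrec F) {α : Type} {f : (α → ℕ) → ℕ}
    (df : DiophFn f) : DiophFn fun v => F (f v) := by
  induction hF generalizing α f with
  | zero => exact const_dioph 0
  | succ => exact add_dioph df (const_dioph 1)
  | left => exact unpair_fst_dioph df
  | right => exact unpair_snd_dioph df
  | pair _ _ hF hG => exact pair_dioph (hF df) (hG df)
  | comp _ _ hF hG => exact hF (hG df)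
  | @prec F G _ _ hF hG =>
    have da := unpair_fst_dioph df
    have dn := unpair_snd_dioph df
    let e : α → Option (Option (Option α)) := some ∘ some ∘ some
    have dk : DiophFn fun v : Option (Option (Option α)) → ℕ => v none := proj_dioph _
    have dc : DiophFn fun v : Option (Option (Option α)) → ℕ => v (some none) := proj_dioph _
    have dc' : DiophFn fun v : Option (Option α) → ℕ => v none := proj_dioph _
    have step := forall_lt_dioph
      (eq_dioph (beta_dioph dc (add_dioph dk (const_dioph 1)))
        (hG (pair_dioph (reindex_diophFn e da) (pair_dioph dk (beta_dioph dc dk)))))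
      (reindex_diophFn (some ∘ some) dn)
    refine ext (ex1_dioph (inter
      (eq_dioph (beta_dioph dc' (const_dioph 0)) (reindex_diophFn (some ∘ some) (hF da)))
      (inter step (eq_dioph (beta_dioph dc' (reindex_diophFn (some ∘ some) dn))
        (proj_dioph (some none)))))) fun v => ?_
    let a := (Nat.unpair (f (v ∘ some))).1
    exact (Nat.rec_eq_iff_exists_beta (z := F a) (g := fun y r => G (Nat.pair a (Nat.pair y r)))
      (n := (Nat.unpair (f (v ∘ some))).2) (x := v none)).symm

theorem exists_primrec_dioph {P : ℕ → ℕ → Bool} (hP : Primrec₂ P) :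
    Dioph {v : Unit → ℕ | ∃ k, P (v ()) k = true} := by
  have h : Nat.Primrec fun n => (P n.unpair.1 n.unpair.2).toNat := by
    rw [← Primrec.nat_iff]
    exact (Primrec.dom_finite Bool.toNat).comp
      (hP.comp (Primrec.fst.comp Primrec.unpair) (Primrec.snd.comp Primrec.unpair))
  refine ext (ex1_dioph (eq_dioph
    (natPrimrec_dioph h (pair_dioph (proj_dioph (some ())) (proj_dioph none))) (const_dioph 1)))
    fun v => exists_congr fun k => ?_
  change (P (Nat.unpair (Nat.pair (v ()) k)).1 (Nat.unpair (Nat.pair (v ()) k)).2).toNat = 1 ↔ _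
  rw [Nat.unpair_pair]
  cases P (v ()) k <;> simp

end Dioph

/-- A Diophantine set of natural numbers that is not computable. -/
theorem exists_dioph_not_computablePred :
    ∃ H : ℕ → Prop, Dioph {v : Unit → ℕ | H (v ())} ∧ ¬ ComputablePred H := by
  open Nat.Partrec in
  -- The halting set is the projection of a primitive recursive relation: `evaln` runs a program
  -- with a bound `k`.
  refine ⟨fun n => (Code.eval (Denumerable.ofNat Code n) 0).Dom, ?_, fun h => ?_⟩
  · have hP : Primrec₂ fun n k : ℕ => (Code.evaln k (Denumerable.ofNat Code n) 0).isSome := by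
      have h : Primrec fun p : ℕ × ℕ => ((p.2, Denumerable.ofNat Code p.1), 0) :=
        (Primrec.snd.pair ((Primrec.ofNat Code).comp Primrec.fst)).pair (Primrec.const 0)
      exact Primrec.option_isSome.comp (Code.primrec_evaln.comp h)
    refine Dioph.ext (Dioph.exists_primrec_dioph hP) fun v => ?_
    change (∃ k, _) ↔ (Code.eval _ 0).Dom
    simp only [Part.dom_iff_mem, Code.evaln_complete, Option.isSome_iff_exists]
    exact exists_comm
  · refine ComputablePred.halting_problem 0 ?_
    obtain ⟨b, hb, hH⟩ := ComputablePred.computable_iff.1 h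
    refine ComputablePred.computable_iff.2 ⟨fun c => b (Encodable.encode c),
      hb.comp Computable.encode, funext fun c => ?_⟩
    rw [← congrFun hH, Denumerable.ofNat_encode]

-- Reduction to elementary equations over the integers

universe u

/-- Elementary arithmetical equations in integer unknowns indexed by `V`. -/
inductive ArithEq (V : Type*) where
  | const (i : V) (c : ℤ)
  | sub (i j k : V)
  | mul (i j k : V)

namespace ArithEq

variable {V W : Type*}

/-- The equation is satisfied by the given values of the unknowns. -/
def Holds (x : V → ℤ) : ArithEq V → Prop
  | const i c => x i = c
  | sub i j k => x i = x j - x k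
  | mul i j k => x i = x j * x k

/-- Renaming of the unknowns. -/
def map (f : V → W) : ArithEq V → ArithEq W
  | const i c => const (f i) c
  | sub i j k => sub (f i) (f j) (f k)
  | mul i j k => mul (f i) (f j) (f k)

theorem holds_map (f : V → W) (x : W → ℤ) (e : ArithEq V) :
    (e.map f).Holds x ↔ e.Holds (x ∘ f) := by
  cases e <;> rfl

theorem exists_finset_support (L : List (ArithEq V)) :
    ∃ F : Finset V, ∀ x y : V → ℤ, (∀ i ∈ F, x i = y i) → ∀ e ∈ L, (e.Holds x ↔ e.Holds y) := by
  classical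
  induction L with
  | nil => exact ⟨∅, by simp⟩
  | cons e L ih =>
    obtain ⟨F, hF⟩ := ih
    obtain ⟨G, hG⟩ : ∃ G : Finset V, ∀ x y : V → ℤ, (∀ i ∈ G, x i = y i) →
        (e.Holds x ↔ e.Holds y) := by
      cases e with
      | const i c => exact ⟨{i}, fun x y h => by simp [Holds, h i]⟩
      | sub i j k => exact ⟨{i, j, k}, fun x y h => by simp [Holds, h i, h j, h k]⟩
      | mul i j k => exact ⟨{i, j, k}, fun x y h => by simp [Holds, h i, h j, h k]⟩
    refine ⟨F ∪ G, fun x y h e' he' => ?_⟩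
    rcases List.mem_cons.1 he' with rfl | he'
    · exact hG x y fun i hi => h i (by simp [hi])
    · exact hF x y (fun i hi => h i (by simp [hi])) e' he'

/-- A finite system involves only finitely many unknowns. -/
theorem exists_fintype_system {V : Type u} (L : List (ArithEq V)) (i₀ : V) :
    ∃ (ι : Type u) (_ : Fintype ι) (j₀ : ι) (L' : List (ArithEq ι)), ∀ n : ℤ,
      (∃ x : V → ℤ, x i₀ = n ∧ ∀ e ∈ L, e.Holds x) ↔
        ∃ x : ι → ℤ, x j₀ = n ∧ ∀ e ∈ L', e.Holds x := by
  classical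
  obtain ⟨F, hF⟩ := exists_finset_support L
  let j₀ : {i // i ∈ insert i₀ F} := ⟨i₀, Finset.mem_insert_self _ _⟩
  let f : V → {i // i ∈ insert i₀ F} := fun i => if h : i ∈ insert i₀ F then ⟨i, h⟩ else j₀
  have hf : ∀ i ∈ insert i₀ F, (f i : V) = i := fun i hi => by simp only [f, dif_pos hi]
  refine ⟨{i // i ∈ insert i₀ F}, inferInstance, j₀, L.map (map f), fun n => ⟨?_, ?_⟩⟩
  · rintro ⟨x, hx, hL⟩
    refine ⟨fun i => x i, hx, fun e he => ?_⟩
    obtain ⟨e, heL, rfl⟩ := List.mem_map.1 he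
    rw [holds_map]
    refine (hF _ x (fun i hi => ?_) e heL).2 (hL e heL)
    exact congrArg x (hf i (Finset.mem_insert_of_mem hi))
  · rintro ⟨x, hx, hL⟩
    refine ⟨x ∘ f, ?_, fun e he => ?_⟩
    · rw [← hx]
      exact congrArg x (Subtype.ext (hf i₀ (Finset.mem_insert_self _ _)))
    · exact (holds_map f x e).1 (hL _ (List.mem_map_of_mem he))

/-- Some finite system, in unknowns indexed by the functions `(γ → ℤ) → ℤ`, expresses the value of
the unknown `F` as the function `F` of the unknowns that are indexed by the projections. -/
def Expresses {γ : Type*} (F : (γ → ℤ) → ℤ) : Prop :=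
  ∃ L : List (ArithEq ((γ → ℤ) → ℤ)), (∀ v : γ → ℤ, ∀ e ∈ L, e.Holds fun g => g v) ∧
    ∀ x, (∀ e ∈ L, e.Holds x) → x F = F fun i => x fun v => v i

variable {γ : Type*} {F G : (γ → ℤ) → ℤ}

theorem Expresses.proj (i : γ) : Expresses fun v : γ → ℤ => v i :=
  ⟨[], by simp, fun _ _ => rfl⟩

theorem Expresses.const (c : ℤ) : Expresses fun _ : γ → ℤ => c :=
  ⟨[.const (fun _ => c) c], by simp [Holds], fun x h => by simpa [Holds] using h⟩

/-- Each function names its own unknown, so systems can be concatenated without choosing fresh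
unknowns, and evaluation at any `v` solves them all at once. -/
theorem Expresses.sub (hF : Expresses F) (hG : Expresses G) :
    Expresses fun v => F v - G v := by
  obtain ⟨L, hL, hF⟩ := hF
  obtain ⟨M, hM, hG⟩ := hG
  refine ⟨.sub (fun v => F v - G v) F G :: (L ++ M), fun v e he => ?_, fun x h => ?_⟩
  · simp only [List.mem_cons, List.mem_append] at he
    rcases he with rfl | he | he
    exacts [rfl, hL v e he, hM v e he]
  · change _ = F _ - G _
    rw [← hF x fun e he => h e (by simp [he]), ← hG x fun e he => h e (by simp [he])]
    exact h _ List.mem_cons_self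

theorem Expresses.mul (hF : Expresses F) (hG : Expresses G) :
    Expresses fun v => F v * G v := by
  obtain ⟨L, hL, hF⟩ := hF
  obtain ⟨M, hM, hG⟩ := hG
  refine ⟨.mul (fun v => F v * G v) F G :: (L ++ M), fun v e he => ?_, fun x h => ?_⟩
  · simp only [List.mem_cons, List.mem_append] at he
    rcases he with rfl | he | he
    exacts [rfl, hL v e he, hM v e he]
  · change _ = F _ * G _
    rw [← hF x fun e he => h e (by simp [he]), ← hG x fun e he => h e (by simp [he])]
    exact h _ List.mem_cons_self

theorem Expresses.add (hF : Expresses F) (hG : Expresses G) :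
    Expresses fun v => F v + G v := by
  simpa using hF.sub ((Expresses.const 0).sub hG)

/-- The sum of the four squares that represent the `i`-th natural number. -/
def fourSq {α : Type*} (i : α) (v : α × Fin 4 → ℤ) : ℤ :=
  v (i, 0) * v (i, 0) + v (i, 1) * v (i, 1) + v (i, 2) * v (i, 2) + v (i, 3) * v (i, 3)

theorem fourSq_nonneg {α : Type*} (i : α) (v : α × Fin 4 → ℤ) : 0 ≤ fourSq i v := by
  exact add_nonneg (add_nonneg (add_nonneg (mul_self_nonneg _) (mul_self_nonneg _))
    (mul_self_nonneg _)) (mul_self_nonneg _)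

theorem expresses_fourSq {α : Type*} (i : α) : Expresses (fourSq i) := by
  have h : ∀ k, Expresses fun v : α × Fin 4 → ℤ => v (i, k) * v (i, k) :=
    fun k => (Expresses.proj _).mul (Expresses.proj _)
  exact (((h 0).add (h 1)).add (h 2)).add (h 3)

theorem exists_fourSq_eq {α : Type*} (t : α → ℕ) :
    ∃ v : α × Fin 4 → ℤ, ∀ i, fourSq i v = t i := by
  choose a b c d h using fun i => Nat.sum_four_squares (t i)
  refine ⟨fun p => ![(a p.1 : ℤ), b p.1, c p.1, d p.1] p.2, fun i => ?_⟩
  rw [← h i]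
  simp [fourSq, pow_two]

theorem expresses_of_isPoly {α : Type*} {f : (α → ℕ) → ℤ} (hf : IsPoly f) :
    Expresses fun v : α × Fin 4 → ℤ => f fun i => (fourSq i v).toNat := by
  induction hf with
  | proj i => simpa [Int.toNat_of_nonneg (fourSq_nonneg _ _)] using expresses_fourSq i
  | const n => exact Expresses.const n
  | sub _ _ hf hg => exact hf.sub hg
  | mul _ _ hf hg => exact hf.mul hg

end ArithEq

-- By Lagrange's theorem, natural solutions are exactly the sums of four integer squares, so integer
-- unknowns suffice.
open ArithEq in
theorem Dioph.exists_arithEq_system {H : ℕ → Prop} (hH : Dioph {v : Unit → ℕ | H (v ())}) :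
    ∃ (ι : Type) (_ : Fintype ι) (i₀ : ι) (L : List (ArithEq ι)), ∀ n : ℕ,
      H n ↔ ∃ x : ι → ℤ, x i₀ = n ∧ ∀ e ∈ L, e.Holds x := by
  obtain ⟨β, p, hp⟩ := hH
  obtain ⟨L, hL, hLp⟩ := expresses_of_isPoly p.isPoly
  obtain ⟨M, hM, hMn⟩ := expresses_fourSq (Sum.inl () : Unit ⊕ β)
  obtain ⟨ι, inst, j₀, L', h'⟩ := exists_fintype_system
    (.const (fun v => p fun i => (fourSq i v).toNat) 0 :: (L ++ M)) (fourSq (Sum.inl ()))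
  refine ⟨ι, inst, j₀, L', fun n => Iff.trans ?_ (h' n)⟩
  rw [show H n ↔ _ from hp fun _ => n]
  constructor
  · rintro ⟨t, ht⟩
    obtain ⟨v, hv⟩ := exists_fourSq_eq (Sum.elim (fun _ : Unit => n) t)
    refine ⟨fun g => g v, hv _, fun e he => ?_⟩
    simp only [List.mem_cons, List.mem_append] at he
    rcases he with rfl | he | he
    · simp only [Holds, hv, Int.toNat_natCast]
      exact ht
    · exact hL v e he
    · exact hM v e he
  · rintro ⟨x, hx, h⟩
    set v : (Unit ⊕ β) × Fin 4 → ℤ := fun i => x fun v => v i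
    have h0 : x (fun v => p fun i => (fourSq i v).toNat) = 0 := h _ List.mem_cons_self
    rw [hLp x fun e he => h e (by simp [he])] at h0
    rw [hMn x fun e he => h e (by simp [he])] at hx
    refine ⟨fun b => (fourSq (Sum.inr b) v).toNat, ?_⟩
    rw [← h0]
    congr 1
    ext (_ | b)
    · change n = (fourSq (Sum.inl ()) v).toNat
      rw [hx, Int.toNat_natCast]
    · rfl

/-! ### Simulation by systems of quadratic forms -/

namespace QuadSystem

/-- The function `F` is a combination `∑_{i<j} a i j * φ i j` with integer coefficients. -/
def IsCombination {X : Type*} {r : ℕ} (φ : X → Fin r → Fin r → ℤ) (F : X → ℤ) : Prop :=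
  ∃ a : Fin r → Fin r → ℤ, ∀ x, ∑ i, ∑ j ∈ Finset.Ioi i, a i j * φ x i j = F x

section IsCombination

variable {X : Type*} {r : ℕ} {φ : X → Fin r → Fin r → ℤ} {F G : X → ℤ}

theorem IsCombination.sub (hF : IsCombination φ F) (hG : IsCombination φ G) :
    IsCombination φ fun x => F x - G x := by
  obtain ⟨a, ha⟩ := hF
  obtain ⟨b, hb⟩ := hG
  refine ⟨fun i j => a i j - b i j, fun x => ?_⟩
  simp only [← ha, ← hb, sub_mul, Finset.sum_sub_distrib]

theorem IsCombination.neg (hF : IsCombination φ F) : IsCombination φ fun x => -F x := by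
  obtain ⟨a, ha⟩ := hF
  refine ⟨fun i j => -a i j, fun x => ?_⟩
  simp only [← ha, neg_mul, Finset.sum_neg_distrib]

theorem isCombination_of_lt {i j : Fin r} (h : i < j) : IsCombination φ fun x => φ x i j := by
  refine ⟨fun k l => if k = i ∧ l = j then 1 else 0, fun x => ?_⟩
  rw [Finset.sum_eq_single i _ (by simp), Finset.sum_eq_single j _ (by simp [h])]
  · simp
  · intro l _ hl
    simp [hl]
  · intro k _ hk
    simp [hk]

end IsCombination

/-- If the systems of some fixed set of equations, together with the equation `F₀ = n`, are
solvable exactly for the `n` with `H n`, then a decision procedure for systems decides `H`. -/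
theorem AlgDecidable.computablePred {P : QuadSystem → Prop} (hd : AlgDecidable P) {X : Type*}
    {r : ℕ} {φ : X → Fin r → Fin r → ℤ}
    (hP : ∀ s a b, P ⟨r, s, a, b⟩ ↔
      ∃ x : X, ∀ q, ∑ i, ∑ j ∈ Finset.Ioi i, a q i j * φ x i j = b q)
    {F₀ : X → ℤ} (hF₀ : IsCombination φ F₀) {L : List ((X → ℤ) × ℤ)}
    (hL : ∀ e ∈ L, IsCombination φ e.1) {H : ℕ → Prop}
    (hH : ∀ n : ℕ, H n ↔ ∃ x, F₀ x = n ∧ ∀ e ∈ L, e.1 x = e.2) : ComputablePred H := by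
  obtain ⟨d, hd, hdP⟩ := hd
  obtain ⟨a₀, ha₀⟩ := hF₀
  choose a ha using fun q : Fin L.length => hL (L.get q) (L.get_mem q)
  -- The input `n` enters only as one right-hand side, so the code is plainly computable from `n`.
  let S : ℕ → QuadSystem := fun n =>
    ⟨r, L.length + 1, Fin.cons a₀ a, Fin.cons (n : ℤ) fun q => (L.get q).2⟩
  have hS : ∀ n, P (S n) ↔ H n := fun n => by
    rw [hP, hH]
    refine exists_congr fun x => ?_
    simp only [Fin.forall_fin_succ, Fin.cons_zero, Fin.cons_succ, ha₀, ha]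
    refine and_congr_right fun _ => ?_
    simp [List.forall_mem_iff_getElem, Fin.forall_iff]
  have hcode : ∃ A R, ∀ n, (S n).code = (r, (A, (n : ℤ)) :: R) :=
    ⟨List.ofFn fun i => List.ofFn fun j => if i < j then a₀ i j else 0,
      List.ofFn fun q => (List.ofFn fun i => List.ofFn fun j => if i < j then a q i j else 0,
        (L.get q).2),
      fun n => by simp only [S, code, List.ofFn_succ, Fin.cons_zero, Fin.cons_succ]⟩
  obtain ⟨A, R, hcode⟩ := hcode
  have hint : Computable fun n : ℕ => (n : ℤ) := by
    -- A nonnegative integer `n` is encoded as `2 * n`.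
    refine (Primrec.encode_iff.1 ?_).to_comp
    exact (Primrec.nat_mul.comp (Primrec.const 2) Primrec.id).of_eq fun n => rfl
  have hcomp : Computable fun n => (S n).code := by
    simp only [hcode]
    exact (Computable.const r).pair (Computable.list_cons.comp
      ((Computable.const A).pair hint) (Computable.const R))
  have hp : Partrec fun n => d (S n).code := hd.comp hcomp
  classical
  refine ComputablePred.computable_iff.2 ⟨fun n => decide (H n), ?_, funext fun n => by simp⟩
  refine Partrec.of_eq hp fun n => Part.eq_some_iff.2 ?_
  by_cases h : H n
  · simpa [h] using (hdP (S n)).1 ((hS n).2 h)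
  · simpa [h] using (hdP (S n)).2 fun h' => h ((hS n).1 h')

/-- The unknowns that simulate a system of arithmetical equations in unknowns indexed by `ι`: two
auxiliary ones, which play the role of the unit, and two copies of each unknown. -/
abbrev Gadget (ι : Type*) : Type _ := Bool ⊕ ι ⊕ ι

namespace Gadget

variable {X ι : Type*} (ψ : X → Gadget ι → Gadget ι → ℤ)

/-- The form whose value is the `i`-th simulated unknown. -/
def val (i : ι) (x : X) : ℤ := ψ x (.inr (.inl i)) (.inl true)

/-- The equation `ψ = 1` for the auxiliary unknowns, the equality of the two copies of each unknown,
and additional equations with right-hand side `0`. -/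
def Base (E : List (X → ℤ)) (x : X) : Prop :=
  ψ x (.inl false) (.inl true) = 1 ∧
    (∀ i, val ψ i x - ψ x (.inl false) (.inr (.inr i)) = 0) ∧ ∀ F ∈ E, F x = 0

/-- The simulation of an arithmetical equation. -/
def simulate : ArithEq ι → (X → ℤ) × ℤ
  | .const i c => (val ψ i, c)
  | .sub i j k => (fun x => val ψ i x - (val ψ j x - val ψ k x), 0)
  | .mul i j k => (fun x => val ψ i x - ψ x (.inr (.inl j)) (.inr (.inr k)), 0)

end Gadget

-- The second copy of each unknown makes squares available: the case `j = k` pairs two distinct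
-- indices, although the forms have no diagonal terms.
open Gadget in
theorem not_algDecidable_of_gadget {P : QuadSystem → Prop} {X : ℕ → Type*}
    {φ : ∀ r, X r → Fin r → Fin r → ℤ}
    (hP : ∀ r s a b, P ⟨r, s, a, b⟩ ↔
      ∃ x : X r, ∀ q, ∑ i, ∑ j ∈ Finset.Ioi i, a q i j * φ r x i j = b q)
    (hcomb : ∀ r (i j : Fin r), i ≠ j → IsCombination (φ r) fun x => φ r x i j)
    (hg : ∀ (ι : Type) [Fintype ι] (r : ℕ) (e : Gadget ι ≃ Fin r), ∃ E : List (X r → ℤ),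
      (∀ F ∈ E, IsCombination (φ r) F) ∧
      (∀ x, Base (fun x i j => φ r x (e i) (e j)) E x → ∀ j k,
        φ r x (e (.inr (.inl j))) (e (.inr (.inr k))) =
          val (fun x i j => φ r x (e i) (e j)) j x * val (fun x i j => φ r x (e i) (e j)) k x) ∧
      ∀ v : ι → ℤ, ∃ x, Base (fun x i j => φ r x (e i) (e j)) E x ∧
        ∀ i, val (fun x i j => φ r x (e i) (e j)) i x = v i) :
    ¬ AlgDecidable P := by
  intro hd
  obtain ⟨H, hH, hnot⟩ := exists_dioph_not_computablePred
  obtain ⟨ι, _, i₀, L, hL⟩ := hH.exists_arithEq_system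
  obtain ⟨E, hE, hmul, hex⟩ := hg ι _ (Fintype.equivFin (Gadget ι))
  set e := Fintype.equivFin (Gadget ι)
  set ψ := fun x i j => φ _ x (e i) (e j)
  have hc : ∀ i j, i ≠ j → IsCombination (φ _) fun x => ψ x i j := fun i j hij =>
    hcomb _ _ _ (e.injective.ne hij)
  have hval : ∀ i, IsCombination (φ _) (val ψ i) := fun i => hc _ _ (by simp)
  refine hnot (hd.computablePred (hP _) (hval i₀)
    (L := (fun x => ψ x (.inl false) (.inl true), 1) ::
      (Finset.univ.toList.map (fun i =>
        ((fun x => val ψ i x - ψ x (.inl false) (.inr (.inr i))), (0 : ℤ))) ++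
      (E.map (fun F => (F, 0)) ++ L.map (simulate ψ)))) ?_ fun n => ?_)
  · intro q hq
    simp only [List.mem_cons, List.mem_append, List.mem_map] at hq
    rcases hq with rfl | ⟨i, _, rfl⟩ | ⟨F, hF, rfl⟩ | ⟨q, hq, rfl⟩
    · exact hc _ _ (by simp)
    · exact (hval i).sub (hc _ _ (by simp))
    · exact hE F hF
    · cases q with
      | const i c => exact hval i
      | sub i j k => exact (hval i).sub ((hval j).sub (hval k))
      | mul i j k => exact (hval i).sub (hc _ _ (by simp))
  · have hsim : ∀ x, Base ψ E x → ∀ q : ArithEq ι,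
        (simulate ψ q).1 x = (simulate ψ q).2 ↔ q.Holds fun i => val ψ i x := by
      intro x hx q
      cases q with
      | const i c => rfl
      | sub i j k => exact sub_eq_zero
      | mul i j k =>
        refine sub_eq_zero.trans ?_
        rw [show ψ x (.inr (.inl j)) (.inr (.inr k)) = _ from hmul x hx j k]
        rfl
    rw [hL]
    simp only [List.forall_mem_cons, List.forall_mem_append, List.forall_mem_map]
    constructor
    · rintro ⟨v, hv, hLv⟩
      obtain ⟨x, hx, hxv⟩ := hex v
      have hxv' : (fun i => val ψ i x) = v := funext hxv
      refine ⟨x, (hxv i₀).trans hv, hx.1, fun i _ => hx.2.1 i, hx.2.2, fun q hq => ?_⟩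
      rw [hsim x hx, hxv']
      exact hLv q hq
    · rintro ⟨x, hx0, h1, h2, h3, h4⟩
      have hx : Base ψ E x := ⟨h1, fun i => h2 i (by simp), h3⟩
      exact ⟨fun i => val ψ i x, hx0, fun q hq => (hsim x hx q).1 (h4 q hq)⟩

end QuadSystem

/-! ### The symmetric and the skew-symmetric case -/

open QuadSystem

theorem not_algDecidable_symSolvable : ¬ AlgDecidable SymSolvable := by
  refine not_algDecidable_of_gadget (X := fun r => Fin r → ℤ) (φ := fun r x i j => x i * x j)
    (fun r s a b => Iff.rfl) (fun r i j hij => ?_) fun ι _ r e => ⟨[], by simp, ?_, fun v => ?_⟩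
  · rcases lt_or_gt_of_ne hij with h | h
    · exact isCombination_of_lt h
    · simpa [mul_comm] using isCombination_of_lt (X := Fin r → ℤ) (φ := fun x i j => x i * x j) h
  · rintro x ⟨h1, h2, -⟩ j k
    have hk := h2 k
    simp only [Gadget.val] at *
    -- Here `e w = 1` gives `p q' = (p w)(e q')`, and `e q' = q w` is the equality of copies.
    linear_combination (-x (e (.inr (.inl j))) * x (e (.inl true))) * hk -
      x (e (.inr (.inl j))) * x (e (.inr (.inr k))) * h1
  · refine ⟨fun i => Sum.elim (fun _ => 1) (Sum.elim v v) (e.symm i), ⟨?_, ?_, ?_⟩, ?_⟩ <;>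
      simp [Gadget.val]

theorem not_algDecidable_skewSolvable : ¬ AlgDecidable SkewSolvable := by
  have hcomb : ∀ r (i j : Fin r), i ≠ j → IsCombination
      (fun (x : (Fin r → ℤ) × (Fin r → ℤ)) i j => x.1 i * x.2 j - x.1 j * x.2 i)
      fun x => x.1 i * x.2 j - x.1 j * x.2 i := by
    intro r i j hij
    rcases lt_or_gt_of_ne hij with h | h
    · exact isCombination_of_lt h
    · simpa using (isCombination_of_lt (X := (Fin r → ℤ) × (Fin r → ℤ))
        (φ := fun x i j => x.1 i * x.2 j - x.1 j * x.2 i) h).neg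
  refine not_algDecidable_of_gadget (X := fun r => (Fin r → ℤ) × (Fin r → ℤ))
    (φ := fun r x i j => x.1 i * x.2 j - x.1 j * x.2 i)
    (fun r s a b => Prod.exists'.symm) hcomb fun ι _ r e => ?_
  -- The extra equations make first copies parallel to `e` and second copies parallel to `w`.
  · refine ⟨Finset.univ.toList.map (fun i x => x.1 (e (.inl false)) * x.2 (e (.inr (.inl i))) -
        x.1 (e (.inr (.inl i))) * x.2 (e (.inl false))) ++
      Finset.univ.toList.map (fun i x => x.1 (e (.inr (.inr i))) * x.2 (e (.inl true)) -
        x.1 (e (.inl true)) * x.2 (e (.inr (.inr i)))), ?_, ?_, fun v => ?_⟩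
    · simp only [List.forall_mem_append, List.forall_mem_map]
      exact ⟨fun i _ => hcomb _ _ _ (by simp), fun i _ => hcomb _ _ _ (by simp)⟩
    · rintro x ⟨h1, h2, h3⟩ j k
      have hk := h2 k
      simp only [List.forall_mem_append, List.forall_mem_map, Finset.mem_toList,
        Finset.mem_univ, true_imp_iff] at h3
      have hA := h3.1 j
      simp only [Gadget.val] at *
      -- Plücker relation: `[e w][p q'] = [p w][e q'] - [q' w][e p]`, with `[e w] = 1` and `[e p] =
      -- 0`.
      linear_combination
        -(x.1 (e (.inr (.inl j))) * x.2 (e (.inr (.inr k))) -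
          x.1 (e (.inr (.inr k))) * x.2 (e (.inr (.inl j)))) * h1 -
        (x.1 (e (.inr (.inr k))) * x.2 (e (.inl true)) -
          x.1 (e (.inl true)) * x.2 (e (.inr (.inr k)))) * hA -
        (x.1 (e (.inr (.inl j))) * x.2 (e (.inl true)) -
          x.1 (e (.inl true)) * x.2 (e (.inr (.inl j)))) * hk
    -- The vectors are `e = (1, 0)`, `w = (0, 1)`, first copies `(v i, 0)` and second copies `(0, v
    -- i)`.
    · refine ⟨⟨fun i => Sum.elim (fun b => if b then 0 else 1) (Sum.elim v 0) (e.symm i),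
        fun i => Sum.elim (fun b => if b then 1 else 0) (Sum.elim 0 v) (e.symm i)⟩,
        ⟨?_, ?_, ?_⟩, ?_⟩
      · simp
      · simp [Gadget.val]
      · simp only [List.forall_mem_append, List.forall_mem_map]
        simp
      · simp [Gadget.val]

theorem mainTheorem3 :
    ¬ QuadSystem.AlgDecidable QuadSystem.SymSolvable ∧
      ¬ QuadSystem.AlgDecidable QuadSystem.SkewSolvable :=
  ⟨not_algDecidable_symSolvable, not_algDecidable_skewSolvable⟩
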